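/- Let $A$ be a closed, densely defined, symmetric operator in a complex Hilbert space $\mathcal H$, let $T\subset A^*$ be an operator with $\overline T=A^*$, and let $\{\mathcal G,\Gamma_0,\Gamma_1\}$ be a quasi boundary triple for $T$: $\mathcal G$ is a Hilbert space and $\Gamma_0,\Gamma_1:\operatorname{dom}T\to\mathcal G$ are linear maps such that (i) $(Tf,g)_{\mathcal H}-(f,Tg)_{\mathcal H}=(\Gamma_1f,\Gamma_0g)_{\mathcal G}-(\Gamma_0f,\Gamma_1g)_{\mathcal G}$ for all $f,g\in\operatorname{dom}T$; (ii) $\Gamma=(\Gamma_0,\Gamma_1)^\top:\operatorname{dom}T\to\mathcal G\times\mathcal G$ has dense range; (iii) $A_0:=T\upharpoonright\ker\Gamma_0$ is self-adjoint in $\mathcal H$. For $\lambda\in\rho(A_0)$ let $\gamma(\lambda)=(\Gamma_0\upharpoonright\ker(T-\lambda))^{-1}$, and let $M(\lambda)=\Gamma_1\gamma(\lambda)$ be the Weyl function, an operator in $\mathcal G$ with domain $\operatorname{ran}\Gamma_0$. Assume that there is $\eta\in\rho(A_0)\cap\mathbb R$ and that $\mathscr G_1:=\operatorname{ran}(\Gamma_1\upharpoonright\ker\Gamma_0)$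 is dense in $\mathcal G$. Let $\mathscr G_1$ be equipped with a norm for which it is a reflexive Banach space continuously embedded in $\mathcal G$ and $\Gamma_1(A_0-\bar\lambda)^{-1}:\mathcal H\to\mathscr G_1$ is continuous for some $\lambda\in\rho(A_0)$. Let $\mathscr G_1'$ be the anti-dual space of $\mathscr G_1$, with $\mathcal G\subset\mathscr G_1'$ via $g\mapsto(g,\cdot)_{\mathcal G}$, and let $\iota_+:\mathscr G_1\to\mathcal G$ and $\iota_-:\mathscr G_1'\to\mathcal G$ be isometric isomorphisms with $(\iota_-x',\iota_+x)_{\mathcal G}=\langle x',x\rangle_{\mathscr G_1'\times\mathscr G_1}$ for all $x\in\mathscr G_1$, $x'\in\mathscr G_1'$. A linear relation $\Theta$ in a Hilbert space is a linear subspace of the product of the space with itself; operators are identified with their graphs; $\operatorname{dom}\Theta=\{x:(x,x')\in\Theta\text{ for some }x'\}$; and $\Theta^*=\{(y,y'):(x',y)=(x,y')\text{ for all }(x,x')\in\Theta\}$. $\Theta$ is symmetric if $\Theta\subset\Theta^*$, self-adjoint if $\Theta=\Theta^*$, dissipative (accumulative) if $\operatorname{Im}(x',x)\ge0$ (respectively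 $\le0$) for all $(x,x')\in\Theta$, and maximal dissipative (maximal accumulative) if in addition it has no proper dissipative (accumulative) extension to a linear relation in the same space. For a linear relation $\Theta$ in $\mathcal G$ put $$\vartheta=\iota_+^{-1}\Theta\iota_-+M(\eta)=\{(x,\iota_+^{-1}y+M(\eta)x): x\in\operatorname{ran}\Gamma_0,\ (\iota_-x,y)\in\Theta\},\qquad A_\vartheta=T\upharpoonright\{f\in\operatorname{dom}T:\Gamma f\in\vartheta\}.$$ Then, for each of the following properties, the mapping $\Theta\mapsto A_\vartheta$ is a bijection from the set of all linear relations $\Theta$ in $\mathcal G$ with that property and $\operatorname{dom}\Theta\subset\operatorname{ran}(\iota_-\Gamma_0)$ onto the set of all operators $B$ in $\mathcal H$ with that property and $A\subset B\subset T$: closed; symmetric; closed and symmetric; self-adjoint; dissipative; closed and dissipative; maximal dissipative; accumulative; closed and accumulative; maximal accumulative. -/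

import Mathlib

namespace QBT

noncomputable section

/-! ### Linear relations

A linear relation from `E` to `F` is a linear subspace of `E × F`; an operator is identified with
its graph.  Scalar products of the literature, linear in the first slot, are
`(x, y) = inner ℂ y x` in Mathlib's convention. -/

section Relations

variable {E F K : Type*} [AddCommGroup E] [Module ℂ E] [AddCommGroup F] [Module ℂ F]
  [AddCommGroup K] [Module ℂ K]

/-- The inverse `{(x', x) : (x, x') ∈ Θ}` of a linear relation. -/
def relInv (Θ : Submodule ℂ (E × F)) : Submodule ℂ (F × E) where
  carrier := {p | (p.2, p.1) ∈ Θ}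
  zero_mem' := Θ.zero_mem
  add_mem' := fun hp hq => Θ.add_mem hp hq
  smul_mem' := fun c _ hp => Θ.smul_mem c hp

/-- The product `Θ₂ Θ₁ = {(x, x'') : (x, x') ∈ Θ₁, (x', x'') ∈ Θ₂}` of linear relations. -/
def relComp (Θ₂ : Submodule ℂ (F × K)) (Θ₁ : Submodule ℂ (E × F)) : Submodule ℂ (E × K) where
  carrier := {p | ∃ y : F, (p.1, y) ∈ Θ₁ ∧ (y, p.2) ∈ Θ₂}
  zero_mem' := ⟨0, Θ₁.zero_mem, Θ₂.zero_mem⟩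
  add_mem' := by
    rintro _ _ ⟨y, hy₁, hy₂⟩ ⟨z, hz₁, hz₂⟩
    exact ⟨y + z, Θ₁.add_mem hy₁ hz₁, Θ₂.add_mem hy₂ hz₂⟩
  smul_mem' := by
    rintro c _ ⟨y, hy₁, hy₂⟩
    exact ⟨c • y, Θ₁.smul_mem c hy₁, Θ₂.smul_mem c hy₂⟩

/-- The (operator-like) sum `{(x, x' + x'') : (x, x') ∈ Θ₁, (x, x'') ∈ Θ₂}`. -/
def relAdd (Θ₁ Θ₂ : Submodule ℂ (E × F)) : Submodule ℂ (E × F) where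
  carrier := {p | ∃ y z : F, (p.1, y) ∈ Θ₁ ∧ (p.1, z) ∈ Θ₂ ∧ p.2 = y + z}
  zero_mem' := ⟨0, 0, Θ₁.zero_mem, Θ₂.zero_mem, by simp⟩
  add_mem' := by
    rintro _ _ ⟨y, z, hy, hz, h⟩ ⟨y', z', hy', hz', h'⟩
    refine ⟨y + y', z + z', Θ₁.add_mem hy hy', Θ₂.add_mem hz hz', ?_⟩
    rw [Prod.snd_add, h, h']
    abel
  smul_mem' := by
    rintro c _ ⟨y, z, hy, hz, h⟩
    refine ⟨c • y, c • z, Θ₁.smul_mem c hy, Θ₂.smul_mem c hz, ?_⟩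
    rw [Prod.smul_snd, h, smul_add]

/-- The relation `Θ - lam = {(x, x' - lam x) : (x, x') ∈ Θ}`. -/
def relSubScalar (Θ : Submodule ℂ (E × E)) (lam : ℂ) : Submodule ℂ (E × E) :=
  relAdd Θ (LinearMap.graph ((-lam) • (LinearMap.id : E →ₗ[ℂ] E)))

/-- The domain of a linear relation. -/
def relDom (Θ : Submodule ℂ (E × F)) : Submodule ℂ E := Θ.map (LinearMap.fst ℂ E F)

end Relations

section HilbertRelations

variable {E : Type*} [NormedAddCommGroup E] [InnerProductSpace ℂ E]

/-- `lam` is in the resolvent set of `Θ`: `(Θ - lam)⁻¹` is (the graph of) a bounded operator that is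
defined on the whole space. -/
def resolventSet (Θ : Submodule ℂ (E × E)) : Set ℂ :=
  {lam | ∃ R : E →L[ℂ] E, relInv (relSubScalar Θ lam) = LinearMap.graph (R : E →ₗ[ℂ] E)}

/-- `Θ ⊂ Θ*`. -/
def IsSymmetricRel (Θ : Submodule ℂ (E × E)) : Prop := Θ ≤ Θ.adjoint

/-- `Θ = Θ*`. -/
def IsSelfAdjointRel (Θ : Submodule ℂ (E × E)) : Prop := Θ = Θ.adjoint

/-- `Im (x', x) ≥ 0` for all `(x, x') ∈ Θ`. -/
def IsDissipativeRel (Θ : Submodule ℂ (E × E)) : Prop :=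
  ∀ p ∈ Θ, 0 ≤ (inner ℂ p.1 p.2).im

/-- `Im (x', x) ≤ 0` for all `(x, x') ∈ Θ`. -/
def IsAccumulativeRel (Θ : Submodule ℂ (E × E)) : Prop :=
  ∀ p ∈ Θ, (inner ℂ p.1 p.2).im ≤ 0

/-- Dissipative without proper dissipative extension in `E`. -/
def IsMaxDissipativeRel (Θ : Submodule ℂ (E × E)) : Prop :=
  IsDissipativeRel Θ ∧ ∀ Θ' : Submodule ℂ (E × E), IsDissipativeRel Θ' → Θ ≤ Θ' → Θ' = Θ

/-- Accumulative without proper accumulative extension in `E`. -/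
def IsMaxAccumulativeRel (Θ : Submodule ℂ (E × E)) : Prop :=
  IsAccumulativeRel Θ ∧ ∀ Θ' : Submodule ℂ (E × E), IsAccumulativeRel Θ' → Θ ≤ Θ' → Θ' = Θ

/-- The relation is a closed subspace of `E × E`. -/
def IsClosedRel (Θ : Submodule ℂ (E × E)) : Prop := IsClosed (Θ : Set (E × E))

end HilbertRelations

/-! ### Quasi boundary triples -/

section Triples

variable {H G : Type*} [NormedAddCommGroup H] [InnerProductSpace ℂ H] [CompleteSpace H]
  [NormedAddCommGroup G] [InnerProductSpace ℂ G] [CompleteSpace G]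

/-- The restriction of `T` to a subspace `p` of its domain. -/
def restrictTo (T : H →ₗ.[ℂ] H) (p : Submodule ℂ T.domain) : H →ₗ.[ℂ] H :=
  T.domRestrict (p.map T.domain.subtype)

/-- `A₀ = T ↾ ker Γ₀`. -/
def opA0 (T : H →ₗ.[ℂ] H) (Γ₀ : T.domain →ₗ[ℂ] G) : H →ₗ.[ℂ] H :=
  restrictTo T (LinearMap.ker Γ₀)

/-- `{G, Γ₀, Γ₁}` is a quasi boundary triple for `T ⊂ A*`. -/
structure IsQuasiBoundaryTriple (A T : H →ₗ.[ℂ] H) (Γ₀ Γ₁ : T.domain →ₗ[ℂ] G) : Prop where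
  le_adjoint : T ≤ A.adjoint
  closure_eq : T.closure = A.adjoint
  green : ∀ f g : T.domain,
    inner ℂ (g : H) (T f) - inner ℂ (T g) (f : H)
      = inner ℂ (Γ₀ g) (Γ₁ f) - inner ℂ (Γ₁ g) (Γ₀ f)
  dense_range : DenseRange (fun f : T.domain => (Γ₀ f, Γ₁ f))
  selfAdjoint : IsSelfAdjoint (opA0 T Γ₀)

/-- `𝒢₁ = ran (Γ₁ ↾ ker Γ₀)`. -/
def spaceG1 {T : H →ₗ.[ℂ] H} (Γ₀ Γ₁ : T.domain →ₗ[ℂ] G) : Submodule ℂ G :=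
  (LinearMap.ker Γ₀).map Γ₁

/-- `𝒩_lam(T) = ker (T - lam)`, as a subspace of `dom T`. -/
def defectSpace (T : H →ₗ.[ℂ] H) (lam : ℂ) : Submodule ℂ T.domain :=
  LinearMap.ker (T.toFun - lam • T.domain.subtype)

/-- The `γ`-field `γ(lam) = (Γ₀ ↾ 𝒩_lam(T))⁻¹`, as a relation from `G` to `dom T`
(it is an operator for `lam ∈ ρ(A₀)`). -/
def gammaField (T : H →ₗ.[ℂ] H) (Γ₀ : T.domain →ₗ[ℂ] G) (lam : ℂ) :
    Submodule ℂ (G × T.domain) :=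
  relInv (LinearPMap.graph ⟨defectSpace T lam, Γ₀.comp (defectSpace T lam).subtype⟩)

/-- The Weyl function `M(lam) = Γ₁ γ(lam)`, an operator in `G` (given by its graph) with domain
`ran Γ₀` for `lam ∈ ρ(A₀)`. -/
def weyl (T : H →ₗ.[ℂ] H) (Γ₀ Γ₁ : T.domain →ₗ[ℂ] G) (lam : ℂ) : Submodule ℂ (G × G) :=
  relComp (LinearMap.graph Γ₁) (gammaField T Γ₀ lam)

/-- `A_ϑ = T ↾ {f ∈ dom T : Γ f ∈ ϑ}`. -/
def extensionOf (T : H →ₗ.[ℂ] H) (Γ₀ Γ₁ : T.domain →ₗ[ℂ] G) (ϑ : Submodule ℂ (G × G)) :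
    H →ₗ.[ℂ] H :=
  restrictTo T (ϑ.comap (Γ₀.prod Γ₁))

/-! ### The Gelfand triple `𝒢₁ ↪ G ↪ 𝒢₁'`

A norm on `𝒢₁` is given by a normed space `X` together with an injective linear map `j : X → G`
with range `𝒢₁`, through which `X` and `𝒢₁` are identified.  The anti-dual `𝒢₁'` is `X →L⋆[ℂ] ℂ`. -/

variable {X : Type*} [NormedAddCommGroup X] [NormedSpace ℂ X]

/-- Through `j`, the normed space `X` is `𝒢₁` with a norm such that `𝒢₁` is a reflexive Banach space
that is continuously embedded in `G`, and `Γ₁ (A₀ - conj lam)⁻¹ : H → 𝒢₁` is continuous for some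
`lam ∈ ρ(A₀)` (the bounded operator `S` below: `f` runs through `dom A₀ = ker Γ₀`, and
`A₀ - conj lam` maps `dom A₀` onto `H`). -/
structure IsAdmissibleNorm (T : H →ₗ.[ℂ] H) (Γ₀ Γ₁ : T.domain →ₗ[ℂ] G) (j : X →L[ℂ] G) :
    Prop where
  injective : Function.Injective j
  range_eq : LinearMap.range (j : X →ₗ[ℂ] G) = spaceG1 Γ₀ Γ₁
  complete : CompleteSpace X
  reflexive : Function.Surjective (NormedSpace.inclusionInDoubleDual ℂ X)
  continuous : ∃ lam ∈ resolventSet (opA0 T Γ₀).graph, ∃ S : H →L[ℂ] X,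
    ∀ f : T.domain, Γ₀ f = 0 → j (S (T f - (starRingEnd ℂ) lam • (f : H))) = Γ₁ f

/-- The embedding `G ↪ 𝒢₁'`, `g ↦ (x ↦ (g, x)_G)`. -/
def embAntiDual (j : X →L[ℂ] G) : G →ₗ[ℂ] (X →L⋆[ℂ] ℂ) where
  toFun g := (innerSLFlip ℂ g).comp j
  map_add' g h := by
    ext x
    simp
  map_smul' c g := by
    ext x
    simp

/-- `ι₊ : 𝒢₁ → G` and `ι₋ : 𝒢₁' → G` satisfy `(ι₋ x', ι₊ x)_G = ⟨x', x⟩`. -/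
def IsGelfandPair (ιp : X ≃ₗᵢ[ℂ] G) (ιm : (X →L⋆[ℂ] ℂ) ≃ₗᵢ[ℂ] G) : Prop :=
  ∀ (x' : X →L⋆[ℂ] ℂ) (x : X), inner ℂ (ιp x) (ιm x') = x' x

/-- `ι₋` on `G ⊂ 𝒢₁'`. -/
def iotaMinusOnG (j : X →L[ℂ] G) (ιm : (X →L⋆[ℂ] ℂ) ≃ₗᵢ[ℂ] G) : G →ₗ[ℂ] G :=
  (ιm.toLinearEquiv : (X →L⋆[ℂ] ℂ) →ₗ[ℂ] G).comp (embAntiDual j)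

/-- `ι₊⁻¹ : G → 𝒢₁ ⊂ G`. -/
def iotaPlusInv (j : X →L[ℂ] G) (ιp : X ≃ₗᵢ[ℂ] G) : G →ₗ[ℂ] G :=
  (j : X →ₗ[ℂ] G).comp (ιp.symm.toLinearEquiv : G →ₗ[ℂ] X)

/-- `ϑ = ι₊⁻¹ Θ ι₋ + M(η)`.  Since `dom M(η) ⊂ G`, only the part of `ι₊⁻¹ Θ ι₋ ⊂ 𝒢₁' × 𝒢₁` with
first components in `G ⊂ 𝒢₁'` enters the sum, which is therefore a relation in `G`. -/
def parameter (T : H →ₗ.[ℂ] H) (Γ₀ Γ₁ : T.domain →ₗ[ℂ] G) (j : X →L[ℂ] G) (ιp : X ≃ₗᵢ[ℂ] G)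
    (ιm : (X →L⋆[ℂ] ℂ) ≃ₗᵢ[ℂ] G) (lam : ℂ) (Θ : Submodule ℂ (G × G)) : Submodule ℂ (G × G) :=
  relAdd
    (relComp (LinearMap.graph (iotaPlusInv j ιp))
      (relComp Θ (LinearMap.graph (iotaMinusOnG j ιm))))
    (weyl T Γ₀ Γ₁ lam)

/-- The map `Θ ↦ A_ϑ` with `ϑ = ι₊⁻¹ Θ ι₋ + M(η)` is a bijection from the relations `Θ` in `G` with
`dom Θ ⊂ ran (ι₋ Γ₀)` and the property `P` onto the operators `B` in `H` with `A ⊂ B ⊂ T` whose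
graph has the property `Q`. -/
def Corresponds (A T : H →ₗ.[ℂ] H) (Γ₀ Γ₁ : T.domain →ₗ[ℂ] G) (j : X →L[ℂ] G) (ιp : X ≃ₗᵢ[ℂ] G)
    (ιm : (X →L⋆[ℂ] ℂ) ≃ₗᵢ[ℂ] G) (lam : ℂ)
    (P : Submodule ℂ (G × G) → Prop) (Q : Submodule ℂ (H × H) → Prop) : Prop :=
  Set.BijOn (fun Θ => extensionOf T Γ₀ Γ₁ (parameter T Γ₀ Γ₁ j ιp ιm lam Θ))
    {Θ | P Θ ∧ relDom Θ ≤ LinearMap.range ((iotaMinusOnG j ιm).comp Γ₀)}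
    {B | Q B.graph ∧ A ≤ B ∧ B ≤ T}

end Triples

end

end QBT

namespace QBT

/-! ### Relations, adjoints and abstract boundary maps -/

section BoundaryMaps

variable {H G : Type*} [NormedAddCommGroup H] [InnerProductSpace ℂ H]
  [NormedAddCommGroup G] [InnerProductSpace ℂ G]

/-! The quasi boundary triple is replaced by an honest boundary map for the whole of `A*`, for which
the correspondence of properties is formal. Let `R = (A₀ - η)⁻¹`, symmetric because `η` is real, let
`S = Γ₁ R`, which is bounded onto `𝒢₁`, and let `L = ι₊ S`, which is bounded onto `G`. Then `A`
consists of the pairs `(R h, h + η R h)` with `L h = 0`, and every element of `A*` is uniquely `(k,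
h + η k)` with `k = R h + L* u`. The map `Λ` sending this element to `(u, L h)` satisfies Green's
identity, has kernel `A`, and is a topological quotient map by the open mapping theorem
(`exists_isBoundaryMap`).

Hence `Θ ↦ Λ⁻¹(Θ)` is a bijection onto the relations between `A` and `A*`. It respects closedness
because `Λ` is a quotient map, and adjoints and imaginary parts by Green's identity. It respects
maximality because every dissipative or accumulative extension of `A` already lies in `A*`
(`le_adjoint_of_im_inner_nonneg`).

The link with `T` is that `Λ` takes the value `(ι₋ Γ₀ f, ι₊ S (T - η) f)` at `(f, T f)`
(`graph_eq_maximalParam`). Since `j S (T - η) f = Γ₁ f - M(η) Γ₀ f`, the condition `Γ f ∈ ϑ` reads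
`Λ (f, T f) ∈ Θ` (`mem_parameter_iff`). Finally, elements of `A*` with `u = 0` lie in `A₀ ⊂ T`, so
the first component of `Λ` decides membership in `T`; this turns `dom Θ ⊂ ran (ι₋ Γ₀)` into `Λ⁻¹(Θ)
⊂ T`. -/

theorem isClosed_adjoint {E F : Type*} [NormedAddCommGroup E] [InnerProductSpace ℂ E]
    [NormedAddCommGroup F] [InnerProductSpace ℂ F] (g : Submodule ℂ (E × F)) :
    IsClosed (g.adjoint : Set (F × E)) := by
  have : (g.adjoint : Set (F × E)) =
      ⋂ p ∈ (g : Set (E × F)), {x | inner ℂ p.2 x.1 - inner ℂ p.1 x.2 = 0} := by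
    ext x
    simp [Submodule.mem_adjoint_iff]
  rw [this]
  exact isClosed_biInter fun p _ => isClosed_eq (by fun_prop) continuous_const

theorem adjoint_anti {E F : Type*} [NormedAddCommGroup E] [InnerProductSpace ℂ E]
    [NormedAddCommGroup F] [InnerProductSpace ℂ F] {g g' : Submodule ℂ (E × F)} (h : g ≤ g') :
    g'.adjoint ≤ g.adjoint := fun x hx => by
  rw [Submodule.mem_adjoint_iff] at hx ⊢
  exact fun a b hab => hx a b (h hab)

/-- Up to the rotation `(x, y) ↦ (y, -x)`, the adjoint is an orthogonal complement. The argument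
runs in `WithLp 2 (E × F)`, where the product carries a Hilbert norm, and uses that a closed
subspace equals its double complement. -/
theorem adjoint_adjoint_le_of_isClosed {E F : Type*} [NormedAddCommGroup E]
    [InnerProductSpace ℂ E] [CompleteSpace E] [NormedAddCommGroup F] [InnerProductSpace ℂ F]
    [CompleteSpace F] {g : Submodule ℂ (E × F)} (hg : IsClosed (g : Set (E × F))) :
    g.adjoint.adjoint ≤ g := by
  intro x hx
  let K : Submodule ℂ (WithLp 2 (E × F)) :=
    g.comap (WithLp.linearEquiv 2 ℂ (E × F)).toLinearMap
  have hK : IsClosed (K : Set (WithLp 2 (E × F))) :=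
    hg.preimage (WithLp.prod_continuous_ofLp 2 E F)
  have : CompleteSpace K := hK.completeSpace_coe
  have hx' : WithLp.toLp 2 x ∈ Kᗮᗮ := by
    rw [Submodule.mem_orthogonal]
    intro w hw
    rw [Submodule.mem_orthogonal] at hw
    have hw' : (w.snd, -w.fst) ∈ g.adjoint := by
      rw [Submodule.mem_adjoint_iff]
      intro a b hab
      have := hw (WithLp.toLp 2 (a, b)) hab
      simp only [WithLp.prod_inner_apply] at this
      simp only [inner_neg_right, sub_neg_eq_add]
      rw [add_comm]
      exact this
    have := (Submodule.mem_adjoint_iff _ _).1 hx _ _ hw'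
    simp only [inner_neg_left] at this
    simp only [WithLp.prod_inner_apply]
    have h2 : -(inner ℂ w.fst x.1 + inner ℂ w.snd x.2) = 0 := by rw [← this]; ring
    exact neg_eq_zero.1 h2
  rw [Submodule.orthogonal_orthogonal] at hx'
  exact hx'

/-- A boundary map for the maximal relation `a*`: a topological quotient map onto `G × G` with
kernel `a` that satisfies the abstract Green identity. -/
structure IsBoundaryMap (a : Submodule ℂ (H × H)) (Λ : a.adjoint →ₗ[ℂ] G × G) : Prop where
  isQuotientMap : Topology.IsQuotientMap Λ
  ker_eq : (LinearMap.ker Λ).map a.adjoint.subtype = a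
  green : ∀ p q : a.adjoint,
    inner ℂ (p : H × H).1 (q : H × H).2 - inner ℂ (p : H × H).2 (q : H × H).1
      = inner ℂ (Λ p).1 (Λ q).2 - inner ℂ (Λ p).2 (Λ q).1

/-- The restriction of the maximal relation determined by the boundary condition `Θ`. -/
noncomputable def boundaryRestriction {a : Submodule ℂ (H × H)} (Λ : a.adjoint →ₗ[ℂ] G × G)
    (Θ : Submodule ℂ (G × G)) : Submodule ℂ (H × H) :=
  (Θ.comap Λ).map a.adjoint.subtype

variable {a : Submodule ℂ (H × H)} {Λ : a.adjoint →ₗ[ℂ] G × G}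

theorem coe_mem_boundaryRestriction {Θ : Submodule ℂ (G × G)} (p : a.adjoint) :
    (p : H × H) ∈ boundaryRestriction Λ Θ ↔ Λ p ∈ Θ := by
  simp [boundaryRestriction]

namespace IsBoundaryMap

variable (hΛ : IsBoundaryMap a Λ)
include hΛ

theorem surjective : Function.Surjective Λ := hΛ.isQuotientMap.surjective

theorem le_boundaryRestriction (Θ : Submodule ℂ (G × G)) : a ≤ boundaryRestriction Λ Θ := by
  conv_lhs => rw [← hΛ.ker_eq]
  refine Submodule.map_mono fun p hp => ?_
  rw [Submodule.mem_comap, LinearMap.mem_ker.1 hp]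
  exact Θ.zero_mem

theorem boundaryRestriction_le_iff {Θ Θ' : Submodule ℂ (G × G)} :
    boundaryRestriction Λ Θ ≤ boundaryRestriction Λ Θ' ↔ Θ ≤ Θ' := by
  constructor
  · intro h x hx
    obtain ⟨p, rfl⟩ := hΛ.surjective x
    exact (coe_mem_boundaryRestriction p).1 (h ((coe_mem_boundaryRestriction p).2 hx))
  · exact fun h => Submodule.map_mono (Submodule.comap_mono h)

theorem boundaryRestriction_injective :
    Function.Injective (boundaryRestriction Λ) := fun _ _ h =>
  le_antisymm (hΛ.boundaryRestriction_le_iff.1 h.le) (hΛ.boundaryRestriction_le_iff.1 h.ge)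

/-- A relation that contains the kernel of `Λ` is the full preimage of its image. -/
theorem exists_boundaryRestriction_eq {B : Submodule ℂ (H × H)} (h₁ : a ≤ B)
    (h₂ : B ≤ a.adjoint) : ∃ Θ, boundaryRestriction Λ Θ = B := by
  refine ⟨(B.comap a.adjoint.subtype).map Λ, le_antisymm ?_ ?_⟩
  · rintro _ ⟨p, ⟨q, hq, hpq⟩, rfl⟩
    have hk : p - q ∈ LinearMap.ker Λ := by rw [LinearMap.mem_ker, map_sub, hpq, sub_self]
    have hd : ((p - q : a.adjoint) : H × H) ∈ a :=
      hΛ.ker_eq.le ⟨_, hk, rfl⟩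
    simpa using B.add_mem (h₁ hd) hq
  · intro x hx
    exact ⟨⟨x, h₂ hx⟩, ⟨⟨x, h₂ hx⟩, hx, rfl⟩, rfl⟩

theorem isClosedRel_iff (Θ : Submodule ℂ (G × G)) :
    IsClosedRel Θ ↔ IsClosedRel (boundaryRestriction Λ Θ) := by
  have h : (boundaryRestriction Λ Θ : Set (H × H)) =
      ((↑) : a.adjoint → H × H) '' (Λ ⁻¹' (Θ : Set (G × G))) := rfl
  unfold IsClosedRel
  rw [h, ← hΛ.isQuotientMap.isClosed_preimage]
  exact (isClosed_adjoint a).isClosedEmbedding_subtypeVal.isClosed_iff_image_isClosed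

/-- Green's identity equates the pairings that define the two adjoints. Surjectivity of `Λ` ensures
that all of `Θ` is tested, and `a ≤ boundaryRestriction Λ Θ` keeps the left side inside `a*`, where
`Λ` is defined. -/
theorem adjoint_boundaryRestriction (Θ : Submodule ℂ (G × G)) :
    (boundaryRestriction Λ Θ).adjoint = boundaryRestriction Λ Θ.adjoint := by
  ext x
  constructor
  · intro hx
    have hxa : x ∈ a.adjoint := adjoint_anti (hΛ.le_boundaryRestriction Θ) hx
    refine (coe_mem_boundaryRestriction (Λ := Λ) ⟨x, hxa⟩).2 ?_
    rw [Submodule.mem_adjoint_iff] at hx ⊢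
    intro b b' hb
    obtain ⟨p, hp⟩ := hΛ.surjective (b, b')
    have h₁ := hx _ _ ((coe_mem_boundaryRestriction p).2 (by rwa [hp]))
    have h₂ := hΛ.green p ⟨x, hxa⟩
    rw [hp] at h₂
    linear_combination h₁ + h₂
  · rintro ⟨q, hq, rfl⟩
    rw [Submodule.mem_adjoint_iff]
    rintro _ _ ⟨p, hp, hpe⟩
    have h₁ := (Submodule.mem_adjoint_iff _ _).1 hq (Λ p).1 (Λ p).2 hp
    have h₂ := hΛ.green p q
    simp only [Submodule.subtype_apply] at hpe ⊢
    rw [hpe] at h₂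
    linear_combination h₁ - h₂

theorem isSymmetricRel_iff (Θ : Submodule ℂ (G × G)) :
    IsSymmetricRel Θ ↔ IsSymmetricRel (boundaryRestriction Λ Θ) := by
  unfold IsSymmetricRel
  rw [hΛ.adjoint_boundaryRestriction, hΛ.boundaryRestriction_le_iff]

theorem isSelfAdjointRel_iff (Θ : Submodule ℂ (G × G)) :
    IsSelfAdjointRel Θ ↔ IsSelfAdjointRel (boundaryRestriction Λ Θ) := by
  unfold IsSelfAdjointRel
  rw [hΛ.adjoint_boundaryRestriction, hΛ.boundaryRestriction_injective.eq_iff]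

theorem im_inner_eq (p : a.adjoint) :
    (inner ℂ (p : H × H).1 (p : H × H).2).im = (inner ℂ (Λ p).1 (Λ p).2).im := by
  have h := congrArg Complex.im (hΛ.green p p)
  rw [← inner_conj_symm (p : H × H).2, ← inner_conj_symm (Λ p).2] at h
  simp only [Complex.sub_im, Complex.conj_im] at h
  linarith

theorem isDissipativeRel_iff (Θ : Submodule ℂ (G × G)) :
    IsDissipativeRel Θ ↔ IsDissipativeRel (boundaryRestriction Λ Θ) := by
  constructor
  · rintro h _ ⟨p, hp, rfl⟩
    exact (h _ hp).trans_eq (hΛ.im_inner_eq p).symm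
  · intro h x hx
    obtain ⟨p, rfl⟩ := hΛ.surjective x
    exact (h _ ((coe_mem_boundaryRestriction p).2 hx)).trans_eq (hΛ.im_inner_eq p)

theorem isAccumulativeRel_iff (Θ : Submodule ℂ (G × G)) :
    IsAccumulativeRel Θ ↔ IsAccumulativeRel (boundaryRestriction Λ Θ) := by
  constructor
  · rintro h _ ⟨p, hp, rfl⟩
    exact (hΛ.im_inner_eq p).trans_le (h _ hp)
  · intro h x hx
    obtain ⟨p, rfl⟩ := hΛ.surjective x
    exact (hΛ.im_inner_eq p).symm.trans_le (h _ ((coe_mem_boundaryRestriction p).2 hx))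

end IsBoundaryMap

/-- For small `c` the linear term dominates the quadratic one, and its sign can be chosen through
the argument of `c`. -/
theorem eq_zero_of_forall_im_mul_add_nonneg {z : ℂ} {r : ℝ}
    (h : ∀ c : ℂ, 0 ≤ (c * z).im + Complex.normSq c * r) : z = 0 := by
  by_contra hz
  have hn : 0 < Complex.normSq z := Complex.normSq_pos.2 hz
  have key : ∀ t : ℝ, 0 ≤ -(t * Complex.normSq z) + t ^ 2 * Complex.normSq z * r := by
    intro t
    -- This `c` makes `c * z` equal to `-i t |z|²`.
    have := h (-(t : ℂ) * Complex.I * (starRingEnd ℂ) z)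
    have h1 : -(t : ℂ) * Complex.I * (starRingEnd ℂ) z * z
        = ((-(t * Complex.normSq z) : ℝ) : ℂ) * Complex.I := by
      rw [mul_assoc, ← Complex.normSq_eq_conj_mul_self]
      push_cast
      ring
    rw [h1] at this
    simp only [Complex.normSq_mul, Complex.normSq_neg, Complex.normSq_ofReal, Complex.normSq_I,
      Complex.normSq_conj, Complex.im_ofReal_mul, Complex.I_im] at this
    nlinarith
  -- With this `t` one has `t * r < 1`, so the right side of `key` is negative.
  have k1 := key (1 / (|r| + 1))
  have hr : 0 < |r| + 1 := by positivity
  have : (1 / (|r| + 1)) * r < 1 := by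
    rw [one_div, inv_mul_lt_iff₀ hr]
    linarith [le_abs_self r]
  have h3 : 0 < (1 / (|r| + 1)) * Complex.normSq z := by positivity
  nlinarith

/-- A relation on which the form `s * Im (x', x)` is nonnegative, `s ≠ 0`, lies in the adjoint of
each symmetric relation that it extends. -/
theorem le_adjoint_of_im_inner_nonneg {s : ℝ} (hs : s ≠ 0) {B : Submodule ℂ (H × H)}
    (ha : IsSymmetricRel a) (hB : ∀ p ∈ B, 0 ≤ s * (inner ℂ p.1 p.2).im) (hle : a ≤ B) :
    B ≤ a.adjoint := by
  intro q hq
  rw [Submodule.mem_adjoint_iff]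
  intro f f' hf
  have hff : (inner ℂ f f').im = 0 := by
    have := (Submodule.mem_adjoint_iff _ _).1 (ha hf) _ _ hf
    rw [← inner_conj_symm f'] at this
    have := congrArg Complex.im this
    simp only [Complex.sub_im, Complex.conj_im, Complex.zero_im] at this
    linarith
  -- The form is evaluated at `(f, f') + c q`. Its constant term vanishes because `a` is symmetric,
  -- and the part linear in `c` is the defect of `q` from the adjoint condition.
  have key := eq_zero_of_forall_im_mul_add_nonneg
    (z := s * (inner ℂ f q.2 - inner ℂ f' q.1)) (r := s * (inner ℂ q.1 q.2).im) ?_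
  · have := (mul_eq_zero.1 key).resolve_left (by exact_mod_cast hs)
    linear_combination -this
  · intro c
    have := hB _ (B.add_mem (hle hf) (B.smul_mem c hq))
    simp only [Prod.fst_add, Prod.snd_add, Prod.smul_fst, Prod.smul_snd, inner_add_left,
      inner_add_right, inner_smul_left, inner_smul_right] at this
    rw [← inner_conj_symm q.1 f'] at this
    simp only [Complex.add_im, Complex.add_re, hff, Complex.mul_im, Complex.mul_re, Complex.conj_re,
      Complex.conj_im, Complex.sub_re, Complex.sub_im, Complex.ofReal_re, Complex.ofReal_im,
      Complex.normSq_apply] at this ⊢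
    linarith

namespace IsBoundaryMap

variable (hΛ : IsBoundaryMap a Λ)
include hΛ

/-- Maximality on the `H` side competes with all relations in `H`. By `hQ` the competitors stay
below `a*`, so they are themselves boundary restrictions. -/
theorem maximal_iff {P : Submodule ℂ (G × G) → Prop} {Q : Submodule ℂ (H × H) → Prop}
    (hPQ : ∀ Θ, P Θ ↔ Q (boundaryRestriction Λ Θ))
    (hQ : ∀ B, Q B → a ≤ B → B ≤ a.adjoint) (Θ : Submodule ℂ (G × G)) :
    (P Θ ∧ ∀ Θ', P Θ' → Θ ≤ Θ' → Θ' = Θ) ↔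
      (Q (boundaryRestriction Λ Θ) ∧
        ∀ B, Q B → boundaryRestriction Λ Θ ≤ B → B = boundaryRestriction Λ Θ) := by
  refine and_congr (hPQ Θ) ⟨fun h B hB hle => ?_, fun h Θ' hΘ' hle => ?_⟩
  · have haB := (hΛ.le_boundaryRestriction Θ).trans hle
    obtain ⟨Θ', rfl⟩ := hΛ.exists_boundaryRestriction_eq haB (hQ B hB haB)
    rw [h Θ' ((hPQ Θ').2 hB) (hΛ.boundaryRestriction_le_iff.1 hle)]
  · exact hΛ.boundaryRestriction_injective
      (h _ ((hPQ Θ').1 hΘ') (hΛ.boundaryRestriction_le_iff.2 hle))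

theorem isMaxDissipativeRel_iff (ha : IsSymmetricRel a) (Θ : Submodule ℂ (G × G)) :
    IsMaxDissipativeRel Θ ↔ IsMaxDissipativeRel (boundaryRestriction Λ Θ) :=
  hΛ.maximal_iff hΛ.isDissipativeRel_iff (fun _ hB =>
    le_adjoint_of_im_inner_nonneg one_ne_zero ha fun p hp => by
      rw [one_mul]
      exact hB p hp) Θ

theorem isMaxAccumulativeRel_iff (ha : IsSymmetricRel a) (Θ : Submodule ℂ (G × G)) :
    IsMaxAccumulativeRel Θ ↔ IsMaxAccumulativeRel (boundaryRestriction Λ Θ) :=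
  hΛ.maximal_iff hΛ.isAccumulativeRel_iff (fun _ hB =>
    le_adjoint_of_im_inner_nonneg (neg_ne_zero.2 one_ne_zero) ha fun p hp => by
      linarith [hB p hp]) Θ

end IsBoundaryMap

end BoundaryMaps

/-! ### The minimal relation expressed through the resolvent -/

section MinimalRelation

variable {H G : Type*} [NormedAddCommGroup H] [InnerProductSpace ℂ H]
  [NormedAddCommGroup G] [InnerProductSpace ℂ G]

/-- The relation `{(R h, h + η R h) : L h = 0}`. -/
def minimalRelation (R : H →L[ℂ] H) (L : H →L[ℂ] G) (η : ℝ) : Submodule ℂ (H × H) :=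
  (LinearMap.ker (L : H →ₗ[ℂ] G)).map
    ((R : H →ₗ[ℂ] H).prod (LinearMap.id + (η : ℂ) • (R : H →ₗ[ℂ] H)))

theorem mem_minimalRelation {R : H →L[ℂ] H} {L : H →L[ℂ] G} {η : ℝ} {p : H × H} :
    p ∈ minimalRelation R L η ↔ ∃ h, L h = 0 ∧ p = (R h, h + (η : ℂ) • R h) := by
  constructor
  · rintro ⟨h, hh, rfl⟩
    exact ⟨h, hh, rfl⟩
  · rintro ⟨h, hh, rfl⟩
    exact ⟨h, hh, rfl⟩

theorem inner_add_smul_sub_inner_add_smul {η : ℝ} {f g h k : H} :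
    inner ℂ f (k + (η : ℂ) • g) - inner ℂ (h + (η : ℂ) • f) g = inner ℂ f k - inner ℂ h g := by
  simp only [inner_add_left, inner_add_right, inner_smul_left, inner_smul_right,
    Complex.conj_ofReal]
  ring

end MinimalRelation

/-! ### Parametrization of the maximal relation and its boundary map -/

section Parametrization

variable {H G : Type*} [NormedAddCommGroup H] [InnerProductSpace ℂ H] [CompleteSpace H]
  [NormedAddCommGroup G] [InnerProductSpace ℂ G] [CompleteSpace G]

/-- The adjoint of a surjective bounded operator maps onto the orthogonal complement of the
kernel. -/
theorem exists_adjoint_apply_eq {L : H →L[ℂ] G} (hL : Function.Surjective L) {k : H}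
    (hk : ∀ l, L l = 0 → inner ℂ l k = 0) : ∃ u, ContinuousLinearMap.adjoint L u = k := by
  -- The open mapping theorem gives preimages with norm control. Pairing `L* v` with a preimage of
  -- `v` bounds `L*` from below, so its range is closed and equals `(ker L)ᗮ`.
  obtain ⟨C, hC, hpre⟩ := L.exists_preimage_norm_le hL
  have hanti : AntilipschitzWith ⟨C, hC.le⟩ (ContinuousLinearMap.adjoint L) := by
    refine AddMonoidHomClass.antilipschitz_of_bound _ fun v => ?_
    obtain ⟨x, hx, hxv⟩ := hpre v
    have h : ‖v‖ * ‖v‖ ≤ (C * ‖ContinuousLinearMap.adjoint L v‖) * ‖v‖ := by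
      calc ‖v‖ * ‖v‖ = ‖inner ℂ x (ContinuousLinearMap.adjoint L v)‖ := by
            rw [ContinuousLinearMap.adjoint_inner_right, hx, inner_self_eq_norm_sq_to_K,
              ← pow_two]
            simp
        _ ≤ ‖x‖ * ‖ContinuousLinearMap.adjoint L v‖ := norm_inner_le_norm _ _
        _ ≤ (C * ‖v‖) * ‖ContinuousLinearMap.adjoint L v‖ := by gcongr
        _ = _ := by ring
    rcases (norm_nonneg v).eq_or_lt with h0 | h0
    · rw [← h0]
      exact mul_nonneg hC.le (norm_nonneg _)
    · exact le_of_mul_le_mul_right h h0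
  have hcl : IsClosed (Set.range (ContinuousLinearMap.adjoint L)) :=
    hanti.isClosed_range (ContinuousLinearMap.adjoint L).uniformContinuous
  have hmem : k ∈ (LinearMap.ker (L : H →ₗ[ℂ] G))ᗮ := by
    rw [Submodule.mem_orthogonal]
    exact fun l hl => hk l hl
  rw [ContinuousLinearMap.orthogonal_ker] at hmem
  have : k ∈ closure (Set.range (ContinuousLinearMap.adjoint L)) := hmem
  rwa [hcl.closure_eq] at this

/-- The map `(h, u) ↦ (R h + L* u, h + η (R h + L* u))`. -/
noncomputable def maximalParam (R : H →L[ℂ] H) (L : H →L[ℂ] G) (η : ℝ) : (H × G) →L[ℂ] H × H :=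
  let E := R.comp (ContinuousLinearMap.fst ℂ H G) +
    (ContinuousLinearMap.adjoint L).comp (ContinuousLinearMap.snd ℂ H G)
  E.prod (ContinuousLinearMap.fst ℂ H G + (η : ℂ) • E)

theorem maximalParam_apply (R : H →L[ℂ] H) (L : H →L[ℂ] G) (η : ℝ) (h : H) (u : G) :
    maximalParam R L η (h, u) = (R h + ContinuousLinearMap.adjoint L u,
      h + (η : ℂ) • (R h + ContinuousLinearMap.adjoint L u)) := rfl

variable {R : H →L[ℂ] H} {L : H →L[ℂ] G} {η : ℝ}

theorem maximalParam_green (hR : ∀ x y, inner ℂ (R x) y = inner ℂ x (R y)) (x y : H × G) :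
    inner ℂ (maximalParam R L η x).1 (maximalParam R L η y).2
        - inner ℂ (maximalParam R L η x).2 (maximalParam R L η y).1
      = inner ℂ x.2 (L y.1) - inner ℂ (L x.1) y.2 := by
  obtain ⟨h, u⟩ := x
  obtain ⟨k, v⟩ := y
  simp only [maximalParam_apply]
  rw [inner_add_smul_sub_inner_add_smul, inner_add_left, inner_add_right, hR,
    ContinuousLinearMap.adjoint_inner_left, ContinuousLinearMap.adjoint_inner_right]
  ring

theorem maximalParam_mem (hR : ∀ x y, inner ℂ (R x) y = inner ℂ x (R y)) (x : H × G) :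
    maximalParam R L η x ∈ (minimalRelation R L η).adjoint := by
  rw [Submodule.mem_adjoint_iff]
  intro a b hab
  obtain ⟨h, hh, he⟩ := mem_minimalRelation.1 hab
  have := maximalParam_green (η := η) (L := L) hR (h, 0) x
  simp only [maximalParam_apply, map_zero, add_zero, ← he, hh, inner_zero_left, sub_self] at this
  linear_combination -this

theorem maximalParam_injective (hL : Function.Surjective L) :
    Function.Injective (maximalParam R L η) := by
  rw [injective_iff_map_eq_zero]
  rintro ⟨h, u⟩ he
  rw [maximalParam_apply, Prod.mk_eq_zero] at he
  obtain ⟨h1, h2⟩ := he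
  rw [h1, smul_zero, add_zero] at h2
  rw [h2, map_zero, zero_add] at h1
  obtain ⟨x, hx⟩ := hL u
  have : inner ℂ u u = 0 := by
    nth_rw 1 [← hx]
    rw [← ContinuousLinearMap.adjoint_inner_right, h1, inner_zero_right]
  rw [h2, inner_self_eq_zero.1 this, Prod.mk_zero_zero]

theorem exists_maximalParam_eq (hR : ∀ x y, inner ℂ (R x) y = inner ℂ x (R y))
    (hL : Function.Surjective L) {p : H × H} (hp : p ∈ (minimalRelation R L η).adjoint) :
    ∃ x, maximalParam R L η x = p := by
  obtain ⟨f, f'⟩ := p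
  -- The second component forces `h = f' - η f`. The remainder `f - R h` is orthogonal to `ker L`,
  -- which is exactly the adjoint condition tested on `(R l, l + η R l)`.
  obtain ⟨u, hu⟩ : ∃ u, ContinuousLinearMap.adjoint L u = f - R (f' - (η : ℂ) • f) := by
    refine exists_adjoint_apply_eq hL fun l hl => ?_
    have h := (Submodule.mem_adjoint_iff _ _).1 hp _ _ (mem_minimalRelation.2 ⟨l, hl, rfl⟩)
    rw [inner_sub_right, ← hR]
    simp only [inner_add_left, inner_sub_right, inner_smul_left, inner_smul_right,
      Complex.conj_ofReal] at h ⊢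
    linear_combination h
  refine ⟨(f' - (η : ℂ) • f, u), ?_⟩
  rw [maximalParam_apply, hu, add_sub_cancel, sub_add_cancel]

/-- The boundary map `(R h + L* u, h + η (R h + L* u)) ↦ (u, L h)` exists. -/
theorem exists_isBoundaryMap (hR : ∀ x y, inner ℂ (R x) y = inner ℂ x (R y))
    (hL : Function.Surjective L) :
    ∃ Λ : (minimalRelation R L η).adjoint →ₗ[ℂ] G × G, IsBoundaryMap (minimalRelation R L η) Λ ∧
      ∀ (p : (minimalRelation R L η).adjoint) h u, (p : H × H) = maximalParam R L η (h, u) → Λ p = (u, L h) := by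
  have : CompleteSpace (minimalRelation R L η).adjoint :=
    (isClosed_adjoint _).completeSpace_coe
  let Ψ := (maximalParam R L η).codRestrict _ (maximalParam_mem hR)
  have hinj : LinearMap.ker (Ψ : (H × G) →ₗ[ℂ] (minimalRelation R L η).adjoint) = ⊥ :=
    LinearMap.ker_eq_bot.2 fun x y hxy => maximalParam_injective hL (congrArg Subtype.val hxy)
  have hsurj : LinearMap.range (Ψ : (H × G) →ₗ[ℂ] (minimalRelation R L η).adjoint) = ⊤ := by
    refine LinearMap.range_eq_top.2 fun p => ?_
    obtain ⟨x, hx⟩ := exists_maximalParam_eq hR hL p.2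
    exact ⟨x, Subtype.ext hx⟩
  -- The closed subspace `a*` is complete, so the bounded bijection is a homeomorphism.
  let e := ContinuousLinearEquiv.ofBijective Ψ hinj hsurj
  have he : ∀ x, (e x : H × H) = maximalParam R L η x := fun x => rfl
  let D : (H × G) →L[ℂ] G × G :=
    (ContinuousLinearMap.snd ℂ H G).prod (L.comp (ContinuousLinearMap.fst ℂ H G))
  have hD : ∀ x, D x = (x.2, L x.1) := fun x => rfl
  have hDs : Function.Surjective D := by
    rintro ⟨u, v⟩
    obtain ⟨h, rfl⟩ := hL v
    exact ⟨(h, u), rfl⟩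
  have hΛ : ∀ x, D (e.symm (e x)) = (x.2, L x.1) := fun x => by
    rw [e.symm_apply_apply, hD]
  refine ⟨(D : (H × G) →ₗ[ℂ] G × G).comp (e.symm.toLinearEquiv : _ →ₗ[ℂ] H × G), ⟨?_, ?_, ?_⟩, ?_⟩
  · exact (D.isQuotientMap hDs).comp e.symm.toHomeomorph.isQuotientMap
  · ext p
    rw [mem_minimalRelation]
    constructor
    · rintro ⟨q, hq, rfl⟩
      obtain ⟨⟨h, u⟩, rfl⟩ := e.surjective q
      obtain ⟨rfl, h2⟩ := Prod.mk_eq_zero.1 ((hΛ (h, u)).symm.trans hq)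
      refine ⟨h, h2, ?_⟩
      rw [Submodule.subtype_apply, he, maximalParam_apply, map_zero, add_zero]
    · rintro ⟨h, hh, rfl⟩
      refine ⟨e (h, 0), (hΛ (h, 0)).trans (by rw [hh, Prod.mk_zero_zero]), ?_⟩
      rw [Submodule.subtype_apply, he, maximalParam_apply, map_zero, add_zero]
  · intro p q
    obtain ⟨x, rfl⟩ := e.surjective p
    obtain ⟨y, rfl⟩ := e.surjective q
    have := maximalParam_green (η := η) (L := L) hR x y
    rw [← he, ← he] at this
    change _ = inner ℂ (D (e.symm (e x))).1 (D (e.symm (e y))).2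
      - inner ℂ (D (e.symm (e x))).2 (D (e.symm (e y))).1
    rw [hΛ, hΛ]
    exact this
  · intro p h u hp
    have : p = e (h, u) := Subtype.ext hp
    rw [this]
    exact hΛ (h, u)

end Parametrization

/-! ### Graphs of restrictions -/

section Restrictions

variable {H : Type*} [NormedAddCommGroup H] [InnerProductSpace ℂ H]

theorem mem_graph_restrictTo {T : H →ₗ.[ℂ] H} {p : Submodule ℂ T.domain} {x : H × H} :
    x ∈ (restrictTo T p).graph ↔ ∃ f ∈ p, x = ((f : H), T f) := by
  rw [LinearPMap.mem_graph_iff]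
  constructor
  · rintro ⟨y, h1, h2⟩
    obtain ⟨⟨f, hf, hfy⟩, -⟩ := y.2
    refine ⟨f, hf, Prod.ext (h1.symm.trans hfy.symm) (h2.symm.trans ?_)⟩
    exact LinearPMap.domRestrict_apply hfy.symm
  · rintro ⟨f, hf, rfl⟩
    exact ⟨⟨f, Submodule.mem_map_of_mem hf, f.2⟩, rfl, LinearPMap.domRestrict_apply rfl⟩

theorem restrictTo_le (T : H →ₗ.[ℂ] H) (p : Submodule ℂ T.domain) : restrictTo T p ≤ T :=
  LinearPMap.domRestrict_le

variable {G : Type*} [NormedAddCommGroup G] [InnerProductSpace ℂ G] {T : H →ₗ.[ℂ] H}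
  {Γ₀ Γ₁ : T.domain →ₗ[ℂ] G}

theorem mem_graph_opA0 {x : H × H} :
    x ∈ (opA0 T Γ₀).graph ↔ ∃ f : T.domain, Γ₀ f = 0 ∧ x = ((f : H), T f) :=
  mem_graph_restrictTo

theorem mem_graph_extensionOf {ϑ : Submodule ℂ (G × G)} {x : H × H} :
    x ∈ (extensionOf T Γ₀ Γ₁ ϑ).graph ↔
      ∃ f : T.domain, (Γ₀ f, Γ₁ f) ∈ ϑ ∧ x = ((f : H), T f) :=
  mem_graph_restrictTo

variable {E : Type*} [AddCommGroup E] [Module ℂ E]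

theorem mem_relSubScalar {Θ : Submodule ℂ (E × E)} {lam : ℂ} {x : E × E} :
    x ∈ relSubScalar Θ lam ↔ (x.1, x.2 + lam • x.1) ∈ Θ := by
  constructor
  · rintro ⟨y, z, hy, hz, h⟩
    have hz : z = (-lam) • x.1 := hz
    rw [h, hz, neg_smul, neg_add_cancel_right]
    exact hy
  · intro h
    refine ⟨_, (-lam) • x.1, h, rfl, ?_⟩
    rw [neg_smul, add_neg_cancel_right]

end Restrictions

/-! ### The resolvent of `A₀` and the kernel of the boundary maps -/

section Triples

variable {H G : Type*} [NormedAddCommGroup H] [InnerProductSpace ℂ H]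
  [NormedAddCommGroup G] [InnerProductSpace ℂ G]
  {A T : H →ₗ.[ℂ] H} {Γ₀ Γ₁ : T.domain →ₗ[ℂ] G}

/-- `R` is the resolvent `(A₀ - lam)⁻¹`. -/
def IsResolventAt (T : H →ₗ.[ℂ] H) (Γ₀ : T.domain →ₗ[ℂ] G) (lam : ℂ) (R : H →L[ℂ] H) : Prop :=
  relInv (relSubScalar (opA0 T Γ₀).graph lam) = LinearMap.graph (R : H →ₗ[ℂ] H)

namespace IsResolventAt

variable {lam : ℂ} {R : H →L[ℂ] H} (hR : IsResolventAt T Γ₀ lam R)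
include hR

theorem exists_domain_eq (h : H) :
    ∃ f : T.domain, Γ₀ f = 0 ∧ (f : H) = R h ∧ T f = h + lam • R h := by
  have hm : (h, R h) ∈ LinearMap.graph (R : H →ₗ[ℂ] H) := rfl
  rw [← hR] at hm
  obtain ⟨f, hf, he⟩ := mem_graph_opA0.1 (mem_relSubScalar.1 hm)
  exact ⟨f, hf, (congrArg Prod.fst he).symm, (congrArg Prod.snd he).symm⟩

theorem apply_sub {f : T.domain} (hf : Γ₀ f = 0) : R (T f - lam • (f : H)) = f := by
  have hm : (T f - lam • (f : H), (f : H)) ∈ relInv (relSubScalar (opA0 T Γ₀).graph lam) := by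
    refine mem_relSubScalar.2 (mem_graph_opA0.2 ⟨f, hf, ?_⟩)
    rw [sub_add_cancel]
  rw [hR] at hm
  exact hm.symm

end IsResolventAt

namespace IsQuasiBoundaryTriple

variable [CompleteSpace H] (hΓ : IsQuasiBoundaryTriple A T Γ₀ Γ₁)
include hΓ

theorem inner_resolvent_eq {η : ℝ} {R : H →L[ℂ] H} (hR : IsResolventAt T Γ₀ η R) (x y : H) :
    inner ℂ (R x) y = inner ℂ x (R y) := by
  obtain ⟨f, hf, hfx, hTf⟩ := hR.exists_domain_eq x
  obtain ⟨g, hg, hgy, hTg⟩ := hR.exists_domain_eq y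
  have h := hΓ.green g f
  rw [hf, hg, inner_zero_left, inner_zero_right, sub_zero, hTf, hTg, hfx, hgy,
    inner_add_smul_sub_inner_add_smul] at h
  exact sub_eq_zero.1 h

theorem eq_zero_of_forall_inner {u : G}
    (h : ∀ f : T.domain, inner ℂ (Γ₀ f) u = 0) : u = 0 := by
  have hd : DenseRange fun f : T.domain => Γ₀ f :=
    Prod.fst_surjective.denseRange.comp hΓ.dense_range continuous_fst
  have hu : (fun x => inner ℂ x u) = fun _ => (0 : ℂ) :=
    hd.equalizer (by fun_prop) continuous_const (funext h)
  exact inner_self_eq_zero.1 (congrFun hu u)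

/-- Elements of `A` pair to zero with all of `T`, hence lie in `A₀* = A₀`; Green's identity and the
density of `ran Γ₀` then give `Γ₁ g = 0`. Conversely, if both boundary values vanish, `g` lies in
the adjoint of the closure of `T`, which is `A** = A`. -/
theorem mem_graph_iff (hA_closed : A.IsClosed) (hA_dense : Dense (A.domain : Set H))
    {x : H × H} :
    x ∈ A.graph ↔ ∃ f : T.domain, Γ₀ f = 0 ∧ Γ₁ f = 0 ∧ x = ((f : H), T f) := by
  have hTg : T.graph ≤ A.graph.adjoint := by
    rw [← LinearPMap.adjoint_graph_eq_graph_adjoint hA_dense]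
    exact LinearPMap.le_graph_of_le hΓ.le_adjoint
  constructor
  · intro hx
    have hgreen : ∀ f : T.domain, inner ℂ (T f) x.1 - inner ℂ (f : H) x.2 = 0 := fun f => by
      have h := (Submodule.mem_adjoint_iff _ _).1 (hTg (T.mem_graph f)) _ _ hx
      rw [← inner_conj_symm (T f), ← inner_conj_symm (f : H), ← map_sub]
      have h' : inner ℂ x.1 (T f) - inner ℂ x.2 (f : H) = 0 := by linear_combination -h
      rw [h', map_zero]
    have hmem : x ∈ (opA0 T Γ₀).graph := by
      rw [← LinearPMap.isSelfAdjoint_def.1 hΓ.selfAdjoint,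
        LinearPMap.adjoint_graph_eq_graph_adjoint hΓ.selfAdjoint.dense_domain,
        Submodule.mem_adjoint_iff]
      intro a b hab
      obtain ⟨f, -, hf⟩ := mem_graph_opA0.1 hab
      obtain ⟨rfl, rfl⟩ := Prod.mk.inj hf
      exact hgreen f
    obtain ⟨g, hg, rfl⟩ := mem_graph_opA0.1 hmem
    refine ⟨g, hg, hΓ.eq_zero_of_forall_inner fun f => ?_, rfl⟩
    have h := hΓ.green g f
    rw [hg, inner_zero_right, sub_zero] at h
    linear_combination -h - hgreen f
  · rintro ⟨g, hg0, hg1, rfl⟩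
    refine adjoint_adjoint_le_of_isClosed hA_closed ?_
    rw [← LinearPMap.adjoint_graph_eq_graph_adjoint hA_dense, ← hΓ.closure_eq,
      Submodule.mem_adjoint_iff]
    have hcl : T.IsClosable := (LinearPMap.adjoint_isClosed hA_dense).isClosable.leIsClosable
      hΓ.le_adjoint
    rw [← hcl.graph_closure_eq_closure_graph]
    intro a b hab
    have hclosed : IsClosed {p : H × H | inner ℂ p.2 (g : H) - inner ℂ p.1 (T g) = 0} :=
      isClosed_eq (by fun_prop) continuous_const
    refine closure_minimal ?_ hclosed hab
    intro p hp
    obtain ⟨f, hf1, hf2⟩ := (LinearPMap.mem_graph_iff _).1 hp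
    have h := hΓ.green g f
    rw [hg0, hg1, inner_zero_right, inner_zero_right, sub_zero] at h
    rw [Set.mem_ofPred_eq, ← hf1, ← hf2]
    linear_combination -h

end IsQuasiBoundaryTriple

variable {X : Type*} [NormedAddCommGroup X] [NormedSpace ℂ X] {j : X →L[ℂ] G}

/-- If `Γ₁ (A₀ - conj lam)⁻¹` is bounded into `𝒢₁` for one `lam`, then so is the operator
`Γ₁ (A₀ - η)⁻¹`, which maps onto `𝒢₁`. -/
theorem IsAdmissibleNorm.exists_surjective [CompleteSpace H] (hj : IsAdmissibleNorm T Γ₀ Γ₁ j) {η : ℂ}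
    {R : H →L[ℂ] H} (hR : IsResolventAt T Γ₀ η R) :
    ∃ S : H →L[ℂ] X, Function.Surjective S ∧
      ∀ f : T.domain, Γ₀ f = 0 → j (S (T f - η • (f : H))) = Γ₁ f := by
  obtain ⟨lam, -, S, hS⟩ := hj.continuous
  -- On `dom A₀`, `T f - conj lam f = (T f - η f) + (η - conj lam) f` with `f = R (T f - η f)`.
  have key : ∀ f : T.domain, Γ₀ f = 0 →
      j (S.comp (ContinuousLinearMap.id ℂ H + (η - (starRingEnd ℂ) lam) • R)
        (T f - η • (f : H))) = Γ₁ f := fun f hf => by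
    rw [← hS f hf]
    simp only [ContinuousLinearMap.comp_apply, add_apply,
      smul_apply, ContinuousLinearMap.id_apply, hR.apply_sub hf]
    congr 2
    module
  refine ⟨_, fun x => ?_, key⟩
  have hx : j x ∈ spaceG1 Γ₀ Γ₁ := by
    rw [← hj.range_eq]
    exact ⟨x, rfl⟩
  obtain ⟨f, hf, hfx⟩ := hx
  exact ⟨_, hj.injective ((key f hf).trans hfx)⟩

end Triples

/-! ### The parameter `ϑ` in terms of the boundary map, and the correspondence -/

section Parameter

variable {H G X : Type*} [NormedAddCommGroup H] [InnerProductSpace ℂ H]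
  [NormedAddCommGroup G] [InnerProductSpace ℂ G]
  [NormedAddCommGroup X] [NormedSpace ℂ X]
  {A T : H →ₗ.[ℂ] H} {Γ₀ Γ₁ : T.domain →ₗ[ℂ] G} {j : X →L[ℂ] G}
  {ιp : X ≃ₗᵢ[ℂ] G} {ιm : (X →L⋆[ℂ] ℂ) ≃ₗᵢ[ℂ] G} {η : ℝ} {R : H →L[ℂ] H} {S : H →L[ℂ] X}

theorem mem_weyl {lam : ℂ} {x z : G} :
    (x, z) ∈ weyl T Γ₀ Γ₁ lam ↔
      ∃ g : T.domain, T g = lam • (g : H) ∧ Γ₀ g = x ∧ Γ₁ g = z := by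
  constructor
  · rintro ⟨g, hg, hz⟩
    obtain ⟨y, hy, hyx⟩ := (LinearPMap.mem_graph_iff _).1 hg
    have hy' : (y : T.domain) = g := hy
    have hd := LinearMap.mem_ker.1 y.2
    rw [hy'] at hd
    exact ⟨g, sub_eq_zero.1 hd, hy' ▸ hyx, hz.symm⟩
  · rintro ⟨g, hg, rfl, rfl⟩
    exact ⟨g, (LinearPMap.mem_graph_iff _).2 ⟨⟨g, LinearMap.mem_ker.2 (sub_eq_zero.2 hg)⟩, rfl, rfl⟩,
      rfl⟩

/-- Split `f = f₀ + (f - f₀)` with `f₀ ∈ dom A₀` and `f - f₀ ∈ ker (T - η)`. Then `Γ₁ (f - f₀) =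
M(η) Γ₀ f`, and subtracting `M(η)` from `ϑ` leaves `Γ₁ f₀ = j S (T - η) f`. -/
theorem mem_parameter_iff (hj : Function.Injective j) (hR : IsResolventAt T Γ₀ η R)
    (hS : ∀ f : T.domain, Γ₀ f = 0 → j (S (T f - (η : ℂ) • (f : H))) = Γ₁ f)
    (Θ : Submodule ℂ (G × G)) (f : T.domain) :
    (Γ₀ f, Γ₁ f) ∈ parameter T Γ₀ Γ₁ j ιp ιm η Θ ↔
      (iotaMinusOnG j ιm (Γ₀ f), ιp (S (T f - (η : ℂ) • (f : H)))) ∈ Θ := by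
  obtain ⟨f₀, hf₀, hf₀R, hTf₀⟩ := hR.exists_domain_eq (T f - (η : ℂ) • (f : H))
  have hres : T f₀ - (η : ℂ) • (f₀ : H) = T f - (η : ℂ) • (f : H) := by
    rw [hTf₀, hf₀R, add_sub_cancel_right]
  have hjS : j (S (T f - (η : ℂ) • (f : H))) = Γ₁ f₀ := by rw [← hres, hS f₀ hf₀]
  have hdefect : T (f - f₀) = (η : ℂ) • ((f - f₀ : T.domain) : H) := by
    rw [LinearPMap.map_sub, Submodule.coe_sub, smul_sub, sub_eq_sub_iff_sub_eq_sub, hres]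
  have hΓ₀ : Γ₀ (f - f₀) = Γ₀ f := by rw [map_sub, hf₀, sub_zero]
  constructor
  · rintro ⟨y, z, ⟨w, ⟨v, hv, hw⟩, hy⟩, hz, hyz⟩
    obtain ⟨g, hg, hg0, rfl⟩ := mem_weyl.1 hz
    have hv : v = iotaMinusOnG j ιm (Γ₀ f) := hv
    have hy : y = j (ιp.symm w) := hy
    -- The difference lies in `ker Γ₀ ∩ ker (T - η)`, which is trivial since `η ∈ ρ(A₀)`.
    have hd : f - f₀ = g := by
      have h0 : Γ₀ (f - f₀ - g) = 0 := by rw [map_sub, hΓ₀, hg0, sub_self]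
      have h1 := hR.apply_sub h0
      rw [LinearPMap.map_sub, hdefect, hg, ← smul_sub, ← Submodule.coe_sub, sub_self,
        map_zero] at h1
      exact sub_eq_zero.1 (Subtype.ext h1.symm)
    have hyz' : Γ₁ f = y + Γ₁ g := hyz
    have hw' : w = ιp (S (T f - (η : ℂ) • (f : H))) := by
      apply ιp.symm.injective
      apply hj
      rw [ιp.symm_apply_apply]
      rw [hjS, ← hy, ← sub_eq_of_eq_add hyz', ← hd, map_sub, sub_sub_cancel]
    rw [← hv, ← hw']
    exact hw
  · intro h
    refine ⟨Γ₁ f₀, Γ₁ (f - f₀), ⟨_, ⟨iotaMinusOnG j ιm (Γ₀ f), rfl, h⟩, ?_⟩, mem_weyl.2 ⟨_, hdefect, hΓ₀, rfl⟩, ?_⟩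
    · change Γ₁ f₀ = j (ιp.symm _)
      rw [ιp.symm_apply_apply, hjS]
    · rw [map_sub, add_sub_cancel]

/-- The boundary values of `f ∈ dom T` are `ι₋ Γ₀ f` and `ι₊ S (T - η) f`. -/
theorem graph_eq_maximalParam [CompleteSpace H] [CompleteSpace G]
    (hΓ : IsQuasiBoundaryTriple A T Γ₀ Γ₁)
    (hι : IsGelfandPair ιp ιm) (hR : IsResolventAt T Γ₀ η R)
    (hS : ∀ f : T.domain, Γ₀ f = 0 → j (S (T f - (η : ℂ) • (f : H))) = Γ₁ f) (f : T.domain) :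
    ((f : H), T f) = maximalParam R ((ιp : X →L[ℂ] G).comp S) η
      (T f - (η : ℂ) • (f : H), iotaMinusOnG j ιm (Γ₀ f)) := by
  have hadj : ContinuousLinearMap.adjoint ((ιp : X →L[ℂ] G).comp S) (iotaMinusOnG j ιm (Γ₀ f))
      = f - R (T f - (η : ℂ) • (f : H)) := by
    -- With `l = (A₀ - η) g`, the Gelfand pairing turns the left side into `(Γ₀ f, Γ₁ g)`, which
    -- Green's identity for `f` and `g` evaluates.
    refine ext_inner_left ℂ fun l => ?_
    rw [ContinuousLinearMap.adjoint_inner_right]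
    obtain ⟨g, hg, hgR, hTg⟩ := hR.exists_domain_eq l
    have h1 : inner ℂ (ιp (S l)) (iotaMinusOnG j ιm (Γ₀ f)) = inner ℂ (j (S l)) (Γ₀ f) :=
      hι _ _
    have h2 : j (S l) = Γ₁ g := by
      rw [← hS g hg, hTg, hgR, add_sub_cancel_right]
    have h3 := hΓ.green f g
    rw [hg, inner_zero_left, hTg, hgR] at h3
    change inner ℂ (ιp (S l)) _ = _
    rw [h1, h2, inner_sub_right, ← hΓ.inner_resolvent_eq hR]
    simp only [inner_add_left, inner_sub_right, inner_smul_left, inner_smul_right,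
      Complex.conj_ofReal] at h3 ⊢
    linear_combination h3
  rw [maximalParam_apply, hadj, add_sub_cancel, sub_add_cancel]

theorem IsQuasiBoundaryTriple.graph_eq_minimalRelation [CompleteSpace H] (hΓ : IsQuasiBoundaryTriple A T Γ₀ Γ₁)
    (hA_closed : A.IsClosed) (hA_dense : Dense (A.domain : Set H)) (hj : Function.Injective j)
    (hR : IsResolventAt T Γ₀ η R)
    (hS : ∀ f : T.domain, Γ₀ f = 0 → j (S (T f - (η : ℂ) • (f : H))) = Γ₁ f) :
    A.graph = minimalRelation R ((ιp : X →L[ℂ] G).comp S) η := by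
  have hker : ∀ h, (ιp : X →L[ℂ] G).comp S h = 0 ↔ j (S h) = 0 := fun h => by
    change ιp (S h) = 0 ↔ _
    rw [map_eq_zero_iff ιp ιp.injective, map_eq_zero_iff j hj]
  ext x
  rw [hΓ.mem_graph_iff hA_closed hA_dense, mem_minimalRelation]
  constructor
  · rintro ⟨f, hf0, hf1, rfl⟩
    refine ⟨T f - (η : ℂ) • (f : H), (hker _).2 ((hS f hf0).trans hf1), ?_⟩
    rw [hR.apply_sub hf0, sub_add_cancel]
  · rintro ⟨h, hh, rfl⟩
    obtain ⟨f, hf, hfR, hTf⟩ := hR.exists_domain_eq h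
    refine ⟨f, hf, ?_, by rw [hfR, hTf]⟩
    rw [← hS f hf, hTf, hfR, add_sub_cancel_right, (hker h).1 hh]

/-- The correspondence for a property of relations in `G` and a property of extensions that are
matched by a boundary map. -/
theorem corresponds_of_isBoundaryMap {Λ : A.graph.adjoint →ₗ[ℂ] G × G}
    (hΛ : IsBoundaryMap A.graph Λ) (hT : T.graph ≤ A.graph.adjoint)
    (hfst : ∀ f : T.domain, (Λ ⟨_, hT (T.mem_graph f)⟩).1 = iotaMinusOnG j ιm (Γ₀ f))
    (hparam : ∀ Θ (f : T.domain), (Γ₀ f, Γ₁ f) ∈ parameter T Γ₀ Γ₁ j ιp ιm η Θ ↔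
      Λ ⟨_, hT (T.mem_graph f)⟩ ∈ Θ)
    (hker : ∀ p, (Λ p).1 = 0 → (p : H × H) ∈ T.graph)
    {P : Submodule ℂ (G × G) → Prop} {Q : Submodule ℂ (H × H) → Prop}
    (hPQ : ∀ Θ, P Θ ↔ Q (boundaryRestriction Λ Θ)) :
    Corresponds A T Γ₀ Γ₁ j ιp ιm η P Q := by
  have hgraph : ∀ Θ, boundaryRestriction Λ Θ ≤ T.graph →
      (extensionOf T Γ₀ Γ₁ (parameter T Γ₀ Γ₁ j ιp ιm η Θ)).graph = boundaryRestriction Λ Θ := by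
    intro Θ hΘ
    ext x
    rw [mem_graph_extensionOf]
    constructor
    · rintro ⟨f, hf, rfl⟩
      exact (coe_mem_boundaryRestriction (Λ := Λ) ⟨_, hT (T.mem_graph f)⟩).2 ((hparam Θ f).1 hf)
    · intro hx
      obtain ⟨f, hf1, hf2⟩ := (LinearPMap.mem_graph_iff _).1 (hΘ hx)
      have hxe : x = ((f : H), T f) := Prod.ext hf1.symm hf2.symm
      subst hxe
      exact ⟨f, (hparam Θ f).2
        ((coe_mem_boundaryRestriction (Λ := Λ) ⟨_, hT (T.mem_graph f)⟩).1 hx), rfl⟩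
  have hdom : ∀ Θ, relDom Θ ≤ LinearMap.range ((iotaMinusOnG j ιm).comp Γ₀) ↔
      boundaryRestriction Λ Θ ≤ T.graph := by
    intro Θ
    constructor
    -- Some `f ∈ dom T` has the same first boundary value as `p`; the difference has first boundary
    -- value zero and so lies in `T`.
    · rintro h _ ⟨p, hp, rfl⟩
      obtain ⟨f, hf⟩ := h ⟨Λ p, hp, rfl⟩
      have hd : (Λ (p - ⟨_, hT (T.mem_graph f)⟩)).1 = 0 := by
        rw [map_sub, Prod.fst_sub, hfst]
        exact sub_eq_zero.2 hf.symm
      have := T.graph.add_mem (hker _ hd) (T.mem_graph f)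
      simpa using this
    · rintro h _ ⟨x, hx, rfl⟩
      obtain ⟨p, rfl⟩ := hΛ.surjective x
      obtain ⟨f, hf1, hf2⟩ :=
        (LinearPMap.mem_graph_iff _).1 (h ((coe_mem_boundaryRestriction p).2 hx))
      have hpe : p = ⟨_, hT (T.mem_graph f)⟩ := Subtype.ext (Prod.ext hf1.symm hf2.symm)
      refine ⟨f, ?_⟩
      rw [hpe]
      exact (hfst f).symm
  refine ⟨?_, ?_, ?_⟩
  · rintro Θ ⟨hP, hΘ⟩
    have hg := hgraph Θ ((hdom Θ).1 hΘ)
    refine ⟨?_, LinearPMap.le_of_le_graph ?_, restrictTo_le _ _⟩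
    · rw [hg]
      exact (hPQ Θ).1 hP
    · rw [hg]
      exact hΛ.le_boundaryRestriction Θ
  · rintro Θ ⟨-, hΘ⟩ Θ' ⟨-, hΘ'⟩ he
    apply hΛ.boundaryRestriction_injective
    rw [← hgraph Θ ((hdom Θ).1 hΘ), ← hgraph Θ' ((hdom Θ').1 hΘ')]
    exact congrArg LinearPMap.graph he
  · rintro B ⟨hQ, hAB, hBT⟩
    have hBT' := LinearPMap.le_graph_of_le hBT
    obtain ⟨Θ, hΘ⟩ := hΛ.exists_boundaryRestriction_eq (LinearPMap.le_graph_of_le hAB)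
      (hBT'.trans hT)
    rw [← hΘ] at hBT' hQ
    exact ⟨Θ, ⟨(hPQ Θ).2 hQ, (hdom Θ).2 hBT'⟩,
      LinearPMap.eq_of_eq_graph ((hgraph Θ hBT').trans hΘ)⟩

/-- There is a boundary map for `A*` such that properties of `Θ` and of the extensions of `A` that it
matches correspond. -/
theorem exists_isBoundaryMap_corresponds [CompleteSpace H] [CompleteSpace G]
    (hA_closed : A.IsClosed) (hA_dense : Dense (A.domain : Set H))
    (hΓ : IsQuasiBoundaryTriple A T Γ₀ Γ₁) (hη : (η : ℂ) ∈ resolventSet (opA0 T Γ₀).graph)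
    (hj : IsAdmissibleNorm T Γ₀ Γ₁ j) (hι : IsGelfandPair ιp ιm) :
    ∃ Λ : A.graph.adjoint →ₗ[ℂ] G × G, IsBoundaryMap A.graph Λ ∧
      ∀ {P : Submodule ℂ (G × G) → Prop} {Q : Submodule ℂ (H × H) → Prop},
        (∀ Θ, P Θ ↔ Q (boundaryRestriction Λ Θ)) → Corresponds A T Γ₀ Γ₁ j ιp ιm η P Q := by
  obtain ⟨R, hR⟩ := hη
  have hR : IsResolventAt T Γ₀ η R := hR
  obtain ⟨S, hSs, hS⟩ := hj.exists_surjective hR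
  have hA := hΓ.graph_eq_minimalRelation (ιp := ιp) hA_closed hA_dense hj.injective hR hS
  have hT : T.graph ≤ A.graph.adjoint := by
    rw [← LinearPMap.adjoint_graph_eq_graph_adjoint hA_dense]
    exact LinearPMap.le_graph_of_le hΓ.le_adjoint
  have hRs := hΓ.inner_resolvent_eq hR
  have hL : Function.Surjective ((ιp : X →L[ℂ] G).comp S) := ιp.surjective.comp hSs
  obtain ⟨Λ, hΛ, hval⟩ : ∃ Λ : A.graph.adjoint →ₗ[ℂ] G × G, IsBoundaryMap A.graph Λ ∧
      ∀ (p : A.graph.adjoint) h u,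
        (p : H × H) = maximalParam R ((ιp : X →L[ℂ] G).comp S) η (h, u) →
          Λ p = (u, (ιp : X →L[ℂ] G).comp S h) := by
    rw [hA]
    exact exists_isBoundaryMap hRs hL
  have hvalT : ∀ f : T.domain, Λ ⟨_, hT (T.mem_graph f)⟩ =
      (iotaMinusOnG j ιm (Γ₀ f), ιp (S (T f - (η : ℂ) • (f : H)))) := fun f =>
    hval _ _ _ (graph_eq_maximalParam hΓ hι hR hS f)
  refine ⟨Λ, hΛ, fun hPQ => corresponds_of_isBoundaryMap hΛ hT (fun f => ?_) (fun Θ f => ?_)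
    (fun p hp => ?_) hPQ⟩
  · rw [hvalT]
  · rw [hvalT, mem_parameter_iff hj.injective hR hS]
  -- When `u = 0` the element is `(R h, h + η R h)`, which belongs to the graph of `A₀`.
  · obtain ⟨⟨h, u⟩, hx⟩ := exists_maximalParam_eq hRs hL (adjoint_anti hA.ge p.2)
    rw [hval p h u hx.symm] at hp
    have hu : u = 0 := hp
    rw [hu, maximalParam_apply, map_zero, add_zero] at hx
    obtain ⟨f, -, hfR, hTf⟩ := hR.exists_domain_eq h
    rw [← hx, ← hTf, ← hfR]
    exact T.mem_graph f

end Parameter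

end QBT

theorem mainTheorem5
    {H G X : Type*}
    [NormedAddCommGroup H] [InnerProductSpace ℂ H] [CompleteSpace H]
    [NormedAddCommGroup G] [InnerProductSpace ℂ G] [CompleteSpace G]
    [NormedAddCommGroup X] [NormedSpace ℂ X]
    (A T : H →ₗ.[ℂ] H)
    (hA_closed : A.IsClosed) (hA_dense : Dense (A.domain : Set H)) (hA_symm : A ≤ A.adjoint)
    (Γ₀ Γ₁ : T.domain →ₗ[ℂ] G)
    (hΓ : QBT.IsQuasiBoundaryTriple A T Γ₀ Γ₁)
    (η : ℝ) (hη : (η : ℂ) ∈ QBT.resolventSet (QBT.opA0 T Γ₀).graph)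
    (hG1 : Dense (QBT.spaceG1 Γ₀ Γ₁ : Set G))
    (j : X →L[ℂ] G) (hj : QBT.IsAdmissibleNorm T Γ₀ Γ₁ j)
    (ιp : X ≃ₗᵢ[ℂ] G) (ιm : (X →L⋆[ℂ] ℂ) ≃ₗᵢ[ℂ] G) (hι : QBT.IsGelfandPair ιp ιm) :
    QBT.Corresponds A T Γ₀ Γ₁ j ιp ιm η QBT.IsClosedRel QBT.IsClosedRel ∧
    QBT.Corresponds A T Γ₀ Γ₁ j ιp ιm η QBT.IsSymmetricRel QBT.IsSymmetricRel ∧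
    QBT.Corresponds A T Γ₀ Γ₁ j ιp ιm η
      (fun Θ => QBT.IsClosedRel Θ ∧ QBT.IsSymmetricRel Θ)
      (fun B => QBT.IsClosedRel B ∧ QBT.IsSymmetricRel B) ∧
    QBT.Corresponds A T Γ₀ Γ₁ j ιp ιm η QBT.IsSelfAdjointRel QBT.IsSelfAdjointRel ∧
    QBT.Corresponds A T Γ₀ Γ₁ j ιp ιm η QBT.IsDissipativeRel QBT.IsDissipativeRel ∧
    QBT.Corresponds A T Γ₀ Γ₁ j ιp ιm η
      (fun Θ => QBT.IsClosedRel Θ ∧ QBT.IsDissipativeRel Θ)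
      (fun B => QBT.IsClosedRel B ∧ QBT.IsDissipativeRel B) ∧
    QBT.Corresponds A T Γ₀ Γ₁ j ιp ιm η QBT.IsMaxDissipativeRel QBT.IsMaxDissipativeRel ∧
    QBT.Corresponds A T Γ₀ Γ₁ j ιp ιm η QBT.IsAccumulativeRel QBT.IsAccumulativeRel ∧
    QBT.Corresponds A T Γ₀ Γ₁ j ιp ιm η
      (fun Θ => QBT.IsClosedRel Θ ∧ QBT.IsAccumulativeRel Θ)
      (fun B => QBT.IsClosedRel B ∧ QBT.IsAccumulativeRel B) ∧
    QBT.Corresponds A T Γ₀ Γ₁ j ιp ιm η QBT.IsMaxAccumulativeRel QBT.IsMaxAccumulativeRel := by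
  obtain ⟨Λ, hΛ, h⟩ := QBT.exists_isBoundaryMap_corresponds hA_closed hA_dense hΓ hη hj hι
  have ha : QBT.IsSymmetricRel A.graph := by
    rw [QBT.IsSymmetricRel, ← LinearPMap.adjoint_graph_eq_graph_adjoint hA_dense]
    exact LinearPMap.le_graph_of_le hA_symm
  exact ⟨h hΛ.isClosedRel_iff, h hΛ.isSymmetricRel_iff,
    h fun Θ => and_congr (hΛ.isClosedRel_iff Θ) (hΛ.isSymmetricRel_iff Θ),
    h hΛ.isSelfAdjointRel_iff, h hΛ.isDissipativeRel_iff,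
    h fun Θ => and_congr (hΛ.isClosedRel_iff Θ) (hΛ.isDissipativeRel_iff Θ),
    h (hΛ.isMaxDissipativeRel_iff ha), h hΛ.isAccumulativeRel_iff,
    h fun Θ => and_congr (hΛ.isClosedRel_iff Θ) (hΛ.isAccumulativeRel_iff Θ),
    h (hΛ.isMaxAccumulativeRel_iff ha)⟩
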